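/- Let $n \ge 0$ and let $f : \{0,1\}^n \to \{0,1\}$ be any boolean function. For $x \in \{0,1\}^n$ and $S \subseteq [n]$ let $x^S$ be $x$ with the bits in $S$ flipped. Define - $\deg(f)$: the degree of the unique multilinear real polynomial that agrees with $f$ on $\{0,1\}^n$ (the degree of the zero polynomial being $0$); - the sensitivity $s(f)$: the maximum over $x$ of the number of $i \in [n]$ with $f(x) \ne f(x^{\{i\}})$; - the block sensitivity $\mathrm{bs}(f)$: the maximum over $x$ of the largest $k$ for which there are $k$ pairwise disjoint sets $B_1,\dots,B_k \subseteq [n]$ with $f(x) \ne f(x^{B_j})$ for all $j$; - the certificate complexity $C(f)$: the maximum over $x$ of the least size of a set $S \subseteq [n]$ such that $f$ is constant on $\{y : y_i = x_i \text{ for all } i \in S\}$; - the decision tree depth $\mathrm{DT}(f)$: the minimum, over all deterministic adaptive query algorithms (decision trees) that compute $f$ correctly on every input, of the maximal number of queries made on an input. Then $$\mathrm{bs}(f) \le \sqrt{2/3}\cdot s(f)^4 + 1,$$ $$\mathrm{DT}(f) \le \sqrt{2/3}\cdot \deg(f)^3 + \deg(f),$$ $$C(f) \le \sqrt{2/3}\cdot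 s(f)^5 + s(f).$$ -/

import Mathlib

namespace BoolFn

/-! ### The multilinear polynomial expansion and the degree -/

/-- The multilinear polynomial expansion of `f : {0,1}ⁿ → {0,1}`, that is
`∑_{a : f a = 1} ∏_{a i = 1} x_i ∏_{a i = 0} (1 - x_i)`. It is the unique multilinear real polynomial
that agrees with `f` on `{0,1}ⁿ`, see `eval_expansion`, `degreeOf_expansion_le`,
`eq_expansion`. -/
noncomputable def expansion {n : ℕ} (f : (Fin n → Bool) → Bool) : MvPolynomial (Fin n) ℝ :=
  ∑ a : Fin n → Bool, if f a = true then
    ∏ i : Fin n, (if a i = true then MvPolynomial.X i else 1 - MvPolynomial.X i) else 0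

/-- The expansion of `f` agrees with `f` on `{0,1}ⁿ`. -/
theorem eval_expansion {n : ℕ} (f : (Fin n → Bool) → Bool) (x : Fin n → Bool) :
    MvPolynomial.eval (fun i => if x i = true then (1 : ℝ) else 0) (expansion f) =
      if f x = true then 1 else 0 := by
  unfold expansion
  rw [map_sum, Finset.sum_eq_single x]
  · by_cases h : f x = true
    · simp only [h, if_true, map_prod]
      apply Finset.prod_eq_one
      intro i _
      cases hx : x i <;> simp [hx]
    · simp [h]
  · intro a _ hax
    by_cases h : f a = true
    · simp only [h, if_true, map_prod]
      obtain ⟨i, hi⟩ := Function.ne_iff.mp hax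
      apply Finset.prod_eq_zero (Finset.mem_univ i)
      cases hx : x i <;> cases ha : a i <;> simp_all
    · simp [h]
  · simp

/-- The expansion of `f` is multilinear. -/
theorem degreeOf_expansion_le {n : ℕ} (f : (Fin n → Bool) → Bool) (i : Fin n) :
    (expansion f).degreeOf i ≤ 1 := by
  classical
  unfold expansion
  refine (MvPolynomial.degreeOf_sum_le _ _ _).trans (Finset.sup_le fun a _ => ?_)
  split_ifs
  · refine (MvPolynomial.degreeOf_prod_le _ _ _).trans ?_
    calc _ ≤ ∑ j : Fin n, if j = i then 1 else 0 := by
          refine Finset.sum_le_sum fun j _ => ?_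
          have hX : MvPolynomial.degreeOf i (MvPolynomial.X j : MvPolynomial (Fin n) ℝ) =
              if j = i then 1 else 0 := by
            rw [MvPolynomial.degreeOf_X]; simp [eq_comm]
          split_ifs with h1 h2 h2
          · simp [hX, h2]
          · simp [hX, h2]
          · refine (MvPolynomial.degreeOf_sub_le _ _ _).trans ?_
            simp [hX, h2]
          · refine (MvPolynomial.degreeOf_sub_le _ _ _).trans ?_
            simp [hX, h2]
      _ ≤ 1 := by simp
  · simp

/-- A multilinear polynomial that agrees with `f` on `{0,1}ⁿ` is the expansion of `f`. -/
theorem eq_expansion {n : ℕ} (f : (Fin n → Bool) → Bool) (p : MvPolynomial (Fin n) ℝ)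
    (hp : ∀ i, p.degreeOf i ≤ 1)
    (he : ∀ x : Fin n → Bool, MvPolynomial.eval (fun i => if x i = true then (1 : ℝ) else 0) p =
      if f x = true then 1 else 0) : p = expansion f := by
  rw [← sub_eq_zero]
  refine MvPolynomial.eq_zero_of_eval_zero_at_prod_finset _ (fun _ => {0, 1}) ?_ ?_
  · intro i
    have h := MvPolynomial.degreeOf_sub_le i p (expansion f)
    have h1 := hp i
    have h2 := degreeOf_expansion_le f i
    have h3 : ({0, 1} : Finset ℝ).card = 2 := Finset.card_pair zero_ne_one
    omega
  · intro y hy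
    have hy' : y = fun i => if (decide (y i = 1)) = true then (1 : ℝ) else 0 := by
      funext i
      have := hy i
      simp only [Finset.mem_insert, Finset.mem_singleton] at this
      rcases this with h | h <;> simp [h]
    rw [hy', map_sub, he (fun i => decide (y i = 1)), eval_expansion f (fun i => decide (y i = 1)),
      sub_self]

/-- `deg(f)`: the degree of the multilinear polynomial expansion of `f`. -/
noncomputable def deg {n : ℕ} (f : (Fin n → Bool) → Bool) : ℕ := (expansion f).totalDegree

/-! ### Sensitivity, block sensitivity, certificate complexity -/

/-- `x^S`: the string `x` with the bits in `S` flipped. -/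
def flip {n : ℕ} (x : Fin n → Bool) (S : Finset (Fin n)) : Fin n → Bool :=
  fun i => if i ∈ S then !(x i) else x i

/-- `s_x(f)`: the number of coordinates to which `f` is sensitive at `x`. -/
def sensAt {n : ℕ} (f : (Fin n → Bool) → Bool) (x : Fin n → Bool) : ℕ :=
  (Finset.univ.filter fun i : Fin n => f x ≠ f (flip x {i})).card

/-- `s(f)`: the maximum of `s_x(f)` over all `x`. -/
def sens {n : ℕ} (f : (Fin n → Bool) → Bool) : ℕ := Finset.univ.sup (sensAt f)

/-- `bs_x(f)`: the largest size of a family of pairwise disjoint blocks `B` with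
`f x ≠ f (x^B)`. -/
def blockSensAt {n : ℕ} (f : (Fin n → Bool) → Bool) (x : Fin n → Bool) : ℕ :=
  (Finset.univ.filter fun F : Finset (Finset (Fin n)) =>
    (∀ B ∈ F, ∀ B' ∈ F, B ≠ B' → Disjoint B B') ∧ ∀ B ∈ F, f x ≠ f (flip x B)).sup Finset.card

/-- `bs(f)`: the maximum of `bs_x(f)` over all `x`. -/
def blockSens {n : ℕ} (f : (Fin n → Bool) → Bool) : ℕ := Finset.univ.sup (blockSensAt f)

/-- `S` is a certificate for `f` at `x`: `f` is constant on the subcube of the points that agree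
with `x` on `S`. -/
def IsCertificate {n : ℕ} (f : (Fin n → Bool) → Bool) (x : Fin n → Bool) (S : Finset (Fin n)) :
    Prop :=
  ∀ y : Fin n → Bool, (∀ i ∈ S, y i = x i) → f y = f x

/-- `C_x(f)`: the least size of a certificate for `f` at `x`. -/
noncomputable def certAt {n : ℕ} (f : (Fin n → Bool) → Bool) (x : Fin n → Bool) : ℕ :=
  sInf {k : ℕ | ∃ S : Finset (Fin n), IsCertificate f x S ∧ S.card = k}

/-- The minimum in the definition of `C_x(f)` is attained. -/
theorem exists_certAt {n : ℕ} (f : (Fin n → Bool) → Bool) (x : Fin n → Bool) :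
    ∃ S : Finset (Fin n), IsCertificate f x S ∧ S.card = certAt f x := by
  have hne : {k : ℕ | ∃ S : Finset (Fin n), IsCertificate f x S ∧ S.card = k}.Nonempty :=
    ⟨_, Finset.univ, fun y hy => congrArg f (funext fun i => hy i (Finset.mem_univ i)), rfl⟩
  exact Nat.sInf_mem hne

/-- `C(f)`: the maximum of `C_x(f)` over all `x`. -/
noncomputable def cert {n : ℕ} (f : (Fin n → Bool) → Bool) : ℕ := Finset.univ.sup (certAt f)

/-! ### Decision trees -/

/-- Deterministic decision trees (adaptive query algorithms) on `n` bits: either stop with an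
answer, or query a bit and continue with the first subtree if it is `0`, with the second if it
is `1`. -/
inductive QueryTree (n : ℕ) : Type
  | leaf (b : Bool) : QueryTree n
  | query (i : Fin n) (t₀ t₁ : QueryTree n) : QueryTree n

/-- The answer of a decision tree on the input `x`. -/
def QueryTree.output {n : ℕ} : QueryTree n → (Fin n → Bool) → Bool
  | .leaf b, _ => b
  | .query i t₀ t₁, x => if x i = true then t₁.output x else t₀.output x

/-- The number of queries that a decision tree makes on the input `x`. -/
def QueryTree.queries {n : ℕ} : QueryTree n → (Fin n → Bool) → ℕ
  | .leaf _, _ => 0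
  | .query i t₀ t₁, x => (if x i = true then t₁.queries x else t₀.queries x) + 1

/-- The cost of a decision tree: the maximal number of queries over all inputs. -/
def QueryTree.cost {n : ℕ} (t : QueryTree n) : ℕ := Finset.univ.sup t.queries

/-- `DT(f)`: the minimum cost of a decision tree that computes `f`. -/
noncomputable def dtDepth {n : ℕ} (f : (Fin n → Bool) → Bool) : ℕ :=
  sInf {k : ℕ | ∃ t : QueryTree n, (∀ x, t.output x = f x) ∧ t.cost = k}

/-- Every boolean function is computed by some decision tree. -/
theorem exists_queryTree {n : ℕ} (f : (Fin n → Bool) → Bool) :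
    ∃ t : QueryTree n, ∀ x, t.output x = f x := by
  have key : ∀ (S : Finset (Fin n)) (g : (Fin n → Bool) → Bool),
      (∀ x y : Fin n → Bool, (∀ i ∈ S, x i = y i) → g x = g y) →
        ∃ t : QueryTree n, ∀ x, t.output x = g x := by
    intro S
    induction S using Finset.induction_on with
    | empty =>
      intro g hg
      exact ⟨.leaf (g fun _ => false), fun x => hg _ _ (by simp)⟩
    | insert i S _ ih =>
      intro g hg
      have hb : ∀ b : Bool, ∃ t : QueryTree n, ∀ x, t.output x = g (Function.update x i b) := by
        intro b
        refine ih (fun x => g (Function.update x i b)) fun x y hxy => hg _ _ fun j hj => ?_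
        by_cases hji : j = i
        · subst hji; simp
        · simp [hji, hxy j (Finset.mem_of_mem_insert_of_ne hj hji)]
      obtain ⟨t₀, h₀⟩ := hb false
      obtain ⟨t₁, h₁⟩ := hb true
      refine ⟨.query i t₀ t₁, fun x => ?_⟩
      cases hx : x i
      · have : Function.update x i false = x := by rw [← hx]; simp
        simp [QueryTree.output, hx, h₀, this]
      · have : Function.update x i true = x := by rw [← hx]; simp
        simp [QueryTree.output, hx, h₁, this]
  exact key Finset.univ f fun x y h => congrArg f (funext fun i => h i (Finset.mem_univ i))

/-- The minimum in the definition of `DT(f)` is attained. -/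
theorem exists_dtDepth {n : ℕ} (f : (Fin n → Bool) → Bool) :
    ∃ t : QueryTree n, (∀ x, t.output x = f x) ∧ t.cost = dtDepth f := by
  obtain ⟨t, ht⟩ := exists_queryTree f
  have hne : {k : ℕ | ∃ t : QueryTree n, (∀ x, t.output x = f x) ∧ t.cost = k}.Nonempty :=
    ⟨_, t, ht, rfl⟩
  exact Nat.sInf_mem hne

end BoolFn

namespace BoolFn

/-! Write d for the degree. The three bounds follow from C ≤ bs·s (`cert_le`), DT ≤ bs·d
(`dtDepth_le`), d ≤ s² (`deg_le_sens_sq`) and bs ≤ √(2/3)·d² + 1 (`blockSens_le`).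

The last one carries the constant. Identifying the variables within each of k disjoint sensitive
blocks gives g on k bits with g = 0 at the origin, g = 1 at the unit vectors, and no larger degree.
On the diagonal g becomes a univariate q with values in [0, 1] on [0, 1], whose t² coefficient is at
most -C(k,2). Markov's inequality for the second derivative at the endpoint, where Chebyshev
polynomials are extremal, yields C(k,2) ≤ d²(d² - 1)/3.

For DT, every input has a sensitive block inside any monomial of maximal degree, so querying the
variables of that monomial lowers bs. The bound on d is Huang's theorem combined with the
Gotsman–Linial reduction. Both use that summing against the parity character of M isolates the
coefficient of the monomial M (`sum_parity_mul_eval`). -/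

/-! ### Parity sums and the top coefficient. -/

/-- The real point of the cube given by a bit string. -/
def cubePoint {n : ℕ} (x : Fin n → Bool) : Fin n → ℝ := fun i => if x i = true then 1 else 0

/-- The parity character `(-1)^{∑_{i ∈ M} x_i}`. -/
def parity {n : ℕ} (M : Finset (Fin n)) (x : Fin n → Bool) : ℝ :=
  ∏ i ∈ M, if x i = true then -1 else 1

/-- The exponent of the monomial `∏_{i ∈ M} X_i`. -/
noncomputable def exponent {n : ℕ} (M : Finset (Fin n)) : Fin n →₀ ℕ :=
  Finsupp.indicator M fun _ _ => 1

theorem eval_cubePoint_expansion {n : ℕ} (f : (Fin n → Bool) → Bool) (x : Fin n → Bool) :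
    MvPolynomial.eval (cubePoint x) (expansion f) = if f x = true then 1 else 0 :=
  eval_expansion f x

theorem flip_flip {n : ℕ} (x : Fin n → Bool) (S : Finset (Fin n)) : flip (flip x S) S = x := by
  funext i
  by_cases h : i ∈ S <;> simp [flip, h]

theorem flip_empty {n : ℕ} (x : Fin n → Bool) : flip x ∅ = x := by
  funext i
  simp [flip]

theorem flip_filter_ne {n : ℕ} (x y : Fin n → Bool) :
    flip x (Finset.univ.filter fun i => x i ≠ y i) = y := by
  funext i
  cases hx : x i <;> cases hy : y i <;> simp [flip, hx, hy]

/-- Flipping the bits in `S` is an involution of the cube. -/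
def flipEquiv {n : ℕ} (S : Finset (Fin n)) : (Fin n → Bool) ≃ (Fin n → Bool) where
  toFun x := flip x S
  invFun x := flip x S
  left_inv x := flip_flip x S
  right_inv x := flip_flip x S

theorem parity_flip_singleton {n : ℕ} {M : Finset (Fin n)} {i : Fin n} (hi : i ∈ M)
    (x : Fin n → Bool) : parity M (flip x {i}) = -parity M x := by
  unfold parity
  rw [← Finset.mul_prod_erase M _ hi, ← Finset.mul_prod_erase M _ hi, ← neg_mul]
  congr 1
  · cases h : x i <;> simp [flip, h]
  · refine Finset.prod_congr rfl fun j hj => ?_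
    simp [flip, Finset.ne_of_mem_erase hj]

theorem sum_parity_mul_eq_zero {n : ℕ} {M : Finset (Fin n)} {i : Fin n} (hi : i ∈ M)
    (g : (Fin n → Bool) → ℝ) (hg : ∀ x, g (flip x {i}) = g x) : ∑ x, parity M x * g x = 0 := by
  have h := Equiv.sum_comp (flipEquiv {i}) fun x => parity M x * g x
  simp only [flipEquiv, Equiv.coe_fn_mk, parity_flip_singleton hi, hg, neg_mul,
    Finset.sum_neg_distrib] at h
  linarith

/-- The parity sum of the monomial `∏_{i ∈ M} X_i` itself. -/
noncomputable def paritySum {n : ℕ} (M : Finset (Fin n)) : ℝ :=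
  ∑ x, parity M x * ∏ i ∈ M, cubePoint x i

/-- The product vanishes unless all bits in M are 1, and there the parity is always (-1)^|M|, so
nothing cancels. -/
theorem paritySum_ne_zero {n : ℕ} (M : Finset (Fin n)) : paritySum M ≠ 0 := by
  have h : paritySum M = (-1) ^ M.card * ∑ x, ∏ i ∈ M, cubePoint x i := by
    rw [paritySum, Finset.mul_sum]
    refine Finset.sum_congr rfl fun x _ => ?_
    rw [parity, ← Finset.prod_mul_distrib, ← Finset.prod_const, ← Finset.prod_mul_distrib]
    refine Finset.prod_congr rfl fun i _ => ?_
    cases hx : x i <;> simp [cubePoint, hx]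
  rw [h]
  refine mul_ne_zero (by simp) (ne_of_gt ?_)
  refine Finset.sum_pos' (fun x _ => Finset.prod_nonneg fun i _ => ?_)
    ⟨fun _ => true, Finset.mem_univ _, by simp [cubePoint]⟩
  unfold cubePoint
  split_ifs <;> norm_num

/-- The parity sum of a polynomial of degree at most `|M|` over a subcube in the directions `M`
only sees the coefficient of `∏_{i ∈ M} X_i`. -/
theorem sum_parity_mul_eval {n : ℕ} {M : Finset (Fin n)} {P : MvPolynomial (Fin n) ℝ}
    (hP : P.totalDegree ≤ M.card) (w : Fin n → Bool) :
    ∑ z, parity M z * MvPolynomial.eval (cubePoint (M.piecewise z w)) P =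
      P.coeff (exponent M) * paritySum M := by
  simp_rw [MvPolynomial.eval_eq', Finset.mul_sum]
  rw [Finset.sum_comm, Finset.sum_eq_single (exponent M)]
  · rw [paritySum, Finset.mul_sum]
    refine Finset.sum_congr rfl fun z _ => ?_
    rw [mul_left_comm]
    congr 2
    rw [← Finset.prod_subset (Finset.subset_univ M)]
    · refine Finset.prod_congr rfl fun i hi => ?_
      simp [exponent, hi, cubePoint]
    · intro i _ hi
      simp [exponent, hi]
  · intro m hm hne
    -- A monomial of degree at most |M| divisible by every variable of M is `exponent M`; any other
    -- misses some i ∈ M, does not depend on that bit of z, and cancels in pairs.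
    by_cases hpos : ∀ i ∈ M, 1 ≤ m i
    · exfalso
      apply hne
      have h1 : ∑ i, m i ≤ M.card := by
        refine le_trans ?_ hP
        have := MvPolynomial.le_totalDegree hm
        rwa [Finsupp.sum_fintype _ _ (fun _ => rfl)] at this
      have h2 : ∑ i, exponent M i = M.card := by
        simp [exponent, Finsupp.indicator_apply]
      have h3 : ∀ i ∈ Finset.univ, exponent M i ≤ m i := fun i _ => by
        by_cases hi : i ∈ M
        · simpa [exponent, hi] using hpos i hi
        · simp [exponent, hi]
      have h4 := (Finset.sum_eq_sum_iff_of_le h3).mp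
        (le_antisymm (Finset.sum_le_sum h3) (by rw [h2]; exact h1))
      ext i
      exact (h4 i (Finset.mem_univ i)).symm
    · push Not at hpos
      obtain ⟨i, hi, hmi⟩ := hpos
      refine sum_parity_mul_eq_zero hi _ fun x => ?_
      congr 1
      refine Finset.prod_congr rfl fun j _ => ?_
      by_cases hji : j = i
      · subst hji
        simp [show m j = 0 by omega]
      · by_cases hj : j ∈ M <;> simp [cubePoint, hj, flip, hji]
  · intro h
    simp [MvPolynomial.notMem_support_iff.mp h]

/-- A monomial of maximal degree of the expansion of a boolean function. -/
theorem exists_card_eq_deg {n : ℕ} (f : (Fin n → Bool) → Bool) (hf : expansion f ≠ 0) :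
    ∃ M : Finset (Fin n), M.card = deg f ∧ (expansion f).coeff (exponent M) ≠ 0 := by
  obtain ⟨m, hm, hdeg⟩ := Finset.exists_mem_eq_sup _ (MvPolynomial.support_nonempty.mpr hf)
    fun s : Fin n →₀ ℕ => s.sum fun _ e => e
  have hle : ∀ i, m i ≤ 1 := fun i =>
    (MvPolynomial.degreeOf_le_iff.mp (degreeOf_expansion_le f i)) m hm
  have hexp : m = exponent m.support := by
    ext i
    have := hle i
    by_cases hi : m i = 0
    · simp [exponent, hi]
    · simp [exponent, hi]
      omega
  refine ⟨m.support, ?_, ?_⟩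
  · change _ = Finset.sup _ _
    rw [hdeg, Finsupp.sum, Finset.card_eq_sum_ones]
    refine Finset.sum_congr rfl fun i hi => ?_
    have := hle i
    have := Finsupp.mem_support_iff.mp hi
    omega
  · rw [← hexp]
    exact MvPolynomial.mem_support_iff.mp hm

/-- Any polynomial that agrees with `f` on the cube has degree at least `deg f`. -/
theorem deg_le_totalDegree {n : ℕ} (f : (Fin n → Bool) → Bool) (P : MvPolynomial (Fin n) ℝ)
    (hP : ∀ x, MvPolynomial.eval (cubePoint x) P = if f x = true then 1 else 0) :
    deg f ≤ P.totalDegree := by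
  by_cases hf : expansion f = 0
  · simp [deg, hf]
  obtain ⟨M, hM, hc⟩ := exists_card_eq_deg f hf
  by_contra! hlt
  -- Both polynomials have the same values on the cube, hence the same parity sum, but only the
  -- expansion has a nonzero coefficient at M.
  have h1 := sum_parity_mul_eval (hM.ge : (expansion f).totalDegree ≤ M.card) fun _ => false
  have h2 := sum_parity_mul_eval (hM ▸ hlt.le : P.totalDegree ≤ M.card) fun _ => false
  simp_rw [eval_cubePoint_expansion] at h1
  simp_rw [hP] at h2
  have h0 : P.coeff (exponent M) = 0 := by
    apply MvPolynomial.coeff_eq_zero_of_totalDegree_lt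
    have hsum : (exponent M).sum (fun _ e => e) = M.card := by
      rw [Finsupp.sum_fintype _ _ (fun _ => rfl)]
      simp [exponent, Finsupp.indicator_apply]
    rw [← hM, ← hsum] at hlt
    exact hlt
  rw [h0, h1, zero_mul] at h2
  exact mul_ne_zero hc (paritySum_ne_zero M) h2

/-- Substituting a literal or a constant for each variable does not increase the degree. -/
theorem deg_comp_le {n k : ℕ} (f : (Fin n → Bool) → Bool) (φ : (Fin k → Bool) → Fin n → Bool)
    (hφ : ∀ i, ∃ p : MvPolynomial (Fin k) ℝ, p.totalDegree ≤ 1 ∧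
      ∀ y, MvPolynomial.eval (cubePoint y) p = cubePoint (φ y) i) :
    deg (fun y => f (φ y)) ≤ deg f := by
  choose p hp1 hp using hφ
  refine (deg_le_totalDegree _ (MvPolynomial.bind₁ p (expansion f)) fun y => ?_).trans ?_
  · rw [← eval_cubePoint_expansion f (φ y), MvPolynomial.eval, MvPolynomial.eval₂Hom_bind₁]
    simp only [MvPolynomial.eval] at hp
    simp only [hp]
    rfl
  · rw [MvPolynomial.bind₁, MvPolynomial.aeval_def, MvPolynomial.eval₂_eq]
    refine MvPolynomial.totalDegree_finsetSum_le fun m hm => ?_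
    refine (MvPolynomial.totalDegree_mul _ _).trans ?_
    rw [MvPolynomial.algebraMap_eq, MvPolynomial.totalDegree_C, zero_add]
    refine (MvPolynomial.totalDegree_finsetProd _ _).trans ?_
    refine le_trans (Finset.sum_le_sum fun i _ => ?_) (MvPolynomial.le_totalDegree hm)
    refine (MvPolynomial.totalDegree_pow _ _).trans ?_
    simpa using Nat.mul_le_mul_left (m i) (hp1 i)

/-! ### Sensitive blocks and certificates. -/

theorem card_le_blockSensAt {n : ℕ} {ι : Type*} [Fintype ι] {f : (Fin n → Bool) → Bool}
    {x : Fin n → Bool} {B : ι → Finset (Fin n)} (hd : Pairwise fun j k => Disjoint (B j) (B k))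
    (hs : ∀ j, f x ≠ f (flip x (B j))) : Fintype.card ι ≤ blockSensAt f x := by
  classical
  -- A repeated block would be disjoint from itself, hence empty, hence not sensitive.
  have hinj : Function.Injective B := by
    intro j k hjk
    by_contra hne
    have h : Disjoint (B j) (B k) := hd hne
    rw [← hjk, disjoint_self, Finset.bot_eq_empty] at h
    exact hs j (by rw [h, flip_empty])
  rw [← Finset.card_univ, ← Finset.card_image_of_injective _ hinj]
  refine Finset.le_sup (f := Finset.card) (Finset.mem_filter.mpr ⟨Finset.mem_univ _, ?_, ?_⟩)
  · simp only [Finset.mem_image, Finset.mem_univ, true_and]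
    rintro _ ⟨j, rfl⟩ _ ⟨k, rfl⟩ hne
    exact hd fun h => hne (by rw [h])
  · simpa using hs

theorem exists_blocks {n : ℕ} (f : (Fin n → Bool) → Bool) (x : Fin n → Bool) :
    ∃ B : Fin (blockSensAt f x) → Finset (Fin n),
      (Pairwise fun j k => Disjoint (B j) (B k)) ∧ ∀ j, f x ≠ f (flip x (B j)) := by
  obtain ⟨F, hF, hcard⟩ := Finset.exists_mem_eq_sup
    (Finset.univ.filter fun F : Finset (Finset (Fin n)) =>
      (∀ B ∈ F, ∀ B' ∈ F, B ≠ B' → Disjoint B B') ∧ ∀ B ∈ F, f x ≠ f (flip x B))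
    ⟨∅, by simp⟩ Finset.card
  obtain ⟨-, hd, hs⟩ := Finset.mem_filter.mp hF
  let e : Fin (blockSensAt f x) ≃ F := (F.equivFinOfCardEq hcard.symm).symm
  refine ⟨fun j => e j, fun j k hjk => hd _ (e j).2 _ (e k).2 fun h => hjk ?_,
    fun j => hs _ (e j).2⟩
  exact e.injective (Subtype.ext h)

theorem blockSensAt_le {n : ℕ} (f : (Fin n → Bool) → Bool) (x : Fin n → Bool) :
    blockSensAt f x ≤ blockSens f := Finset.le_sup (Finset.mem_univ x)

theorem sensAt_le {n : ℕ} (f : (Fin n → Bool) → Bool) (x : Fin n → Bool) :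
    sensAt f x ≤ sens f := Finset.le_sup (Finset.mem_univ x)

/-- A sensitive block contains a sensitive block of size at most `s(f)`. -/
theorem exists_subset_card_le_sens {n : ℕ} {f : (Fin n → Bool) → Bool} {x : Fin n → Bool}
    {B : Finset (Fin n)} (hB : f x ≠ f (flip x B)) :
    ∃ S ⊆ B, f x ≠ f (flip x S) ∧ S.card ≤ sens f := by
  -- For a minimal sensitive S, putting back any i ∈ S restores the value `f x`, so `flip x S` is
  -- sensitive to all of S.
  obtain ⟨S, hSB, hS⟩ := exists_minimal_le_of_wellFoundedLT
    (fun S : Finset (Fin n) => f x ≠ f (flip x S)) B hB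
  refine ⟨S, hSB, hS.prop, le_trans (Finset.card_le_card fun i hi => ?_) (sensAt_le f (flip x S))⟩
  have hflip : flip (flip x S) {i} = flip x (S.erase i) := by
    funext j
    by_cases hj : j = i
    · subst hj
      simp [flip, hi]
    · simp [flip, hj]
  have herase : f x = f (flip x (S.erase i)) := by
    by_contra hne
    exact Finset.notMem_erase i S (hS.le_of_le hne (Finset.erase_subset i S) hi)
  rw [Finset.mem_filter, hflip, ← herase]
  exact ⟨Finset.mem_univ i, hS.prop.symm⟩

/-- Shrink the blocks of a largest disjoint family to size at most s; their union is a certificate.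
Otherwise some y agrees with x on the union but has another value, and the set where x and y differ
is one more disjoint sensitive block. -/
theorem certAt_le {n : ℕ} (f : (Fin n → Bool) → Bool) (x : Fin n → Bool) :
    certAt f x ≤ blockSensAt f x * sens f := by
  obtain ⟨B, hd, hs⟩ := exists_blocks f x
  choose S hSB hS hcard using fun j => exists_subset_card_le_sens (hs j)
  have hle : (Finset.univ.biUnion S).card ≤ blockSensAt f x * sens f := by
    simpa using Finset.card_biUnion_le_card_mul Finset.univ S (sens f) fun j _ => hcard j
  refine le_trans ?_ hle
  unfold certAt
  refine Nat.sInf_le ⟨Finset.univ.biUnion S, fun y hy => ?_, rfl⟩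
  by_contra hne
  let D := Finset.univ.filter fun i => x i ≠ y i
  have hD : ∀ j, Disjoint D (S j) := fun j => Finset.disjoint_left.mpr fun i hi hij =>
    (Finset.mem_filter.mp hi).2
      (hy i (Finset.mem_biUnion.mpr ⟨j, Finset.mem_univ j, hij⟩)).symm
  have h := card_le_blockSensAt (f := f) (x := x)
    (B := fun o : Option (Fin (blockSensAt f x)) => o.elim D S) ?_ ?_
  · simp at h
  · rintro (_ | j) (_ | k) hjk
    · exact absurd rfl hjk
    · exact hD k
    · exact (hD j).symm
    · exact Disjoint.mono (hSB j) (hSB k) (hd fun h => hjk (by rw [h]))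
  · rintro (_ | j)
    · simpa [D, flip_filter_ne] using Ne.symm hne
    · exact hS j

theorem cert_le {n : ℕ} (f : (Fin n → Bool) → Bool) : cert f ≤ blockSens f * sens f :=
  Finset.sup_le fun x _ => (certAt_le f x).trans (Nat.mul_le_mul_right _ (blockSensAt_le f x))

/-! ### Decision trees. -/

/-- Query all bits in `M` and continue with a tree for the restricted function. -/
theorem exists_queryTree_of_piecewise {n : ℕ} (M : Finset (Fin n)) {m : ℕ}
    (g : (Fin n → Bool) → Bool)
    (h : ∀ z, ∃ t : QueryTree n, ∀ x, t.output x = g (M.piecewise z x) ∧ t.queries x ≤ m) :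
    ∃ t : QueryTree n, ∀ x, t.output x = g x ∧ t.queries x ≤ M.card + m := by
  induction M using Finset.induction_on generalizing g with
  | empty => simpa using h fun _ => false
  | insert i M hi ih =>
    have hb : ∀ b : Bool, ∃ t : QueryTree n, ∀ x,
        t.output x = g (Function.update x i b) ∧ t.queries x ≤ M.card + m := by
      intro b
      refine ih (fun x => g (Function.update x i b)) fun z => ?_
      obtain ⟨t, ht⟩ := h (Function.update z i b)
      refine ⟨t, fun x => ?_⟩
      have : (insert i M).piecewise (Function.update z i b) x =
          Function.update (M.piecewise z x) i b := by
        funext j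
        by_cases hj : j = i
        · subst hj; simp
        · by_cases hjM : j ∈ M <;> simp [hj, hjM]
      rw [← this]
      exact ht x
    obtain ⟨t₀, h₀⟩ := hb false
    obtain ⟨t₁, h₁⟩ := hb true
    refine ⟨.query i t₀ t₁, fun x => ?_⟩
    rw [Finset.card_insert_of_notMem hi]
    cases hx : x i
    · have := (h₀ x).2
      have : Function.update x i false = x := by rw [← hx]; simp
      simp only [QueryTree.output, QueryTree.queries, hx, h₀, this]
      exact ⟨rfl, by simp; omega⟩
    · have := (h₁ x).2
      have : Function.update x i true = x := by rw [← hx]; simp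
      simp only [QueryTree.output, QueryTree.queries, hx, h₁, this]
      exact ⟨rfl, by simp; omega⟩

theorem deg_piecewise_le {n : ℕ} (g : (Fin n → Bool) → Bool) (M : Finset (Fin n))
    (z : Fin n → Bool) : deg (fun x => g (M.piecewise z x)) ≤ deg g := by
  refine deg_comp_le g (fun x => M.piecewise z x) fun i => ?_
  by_cases hi : i ∈ M
  · exact ⟨MvPolynomial.C (cubePoint z i), by simp, fun y => by simp [cubePoint, hi]⟩
  · exact ⟨MvPolynomial.X i, by simp, fun y => by simp [cubePoint, hi]⟩

theorem deg_pos {n : ℕ} {g : (Fin n → Bool) → Bool} {x y : Fin n → Bool} (h : g x ≠ g y) :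
    0 < deg g := by
  by_contra! h0
  have hC := MvPolynomial.totalDegree_eq_zero_iff_eq_C.mp (Nat.le_zero.mp h0)
  have hx := eval_cubePoint_expansion g x
  have hy := eval_cubePoint_expansion g y
  rw [hC, MvPolynomial.eval_C] at hx hy
  rw [hx] at hy
  cases hgx : g x <;> cases hgy : g y <;> simp_all

/-- Every input has a sensitive block inside a monomial of maximal degree. -/
theorem exists_sensitive_subset {n : ℕ} {g : (Fin n → Bool) → Bool} {M : Finset (Fin n)}
    (hM : M.card = deg g) (hc : (expansion g).coeff (exponent M) ≠ 0) (hpos : 0 < deg g)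
    (w : Fin n → Bool) : ∃ S ⊆ M, g w ≠ g (flip w S) := by
  by_contra! h
  -- Otherwise g is constant on the subcube through w in directions M, so its parity sum vanishes
  -- although the top coefficient does not.
  have hconst : ∀ z, g (M.piecewise z w) = g w := by
    intro z
    rw [← flip_filter_ne w (M.piecewise z w)]
    refine (h _ fun i hi => ?_).symm
    by_contra hiM
    simp [hiM] at hi
  obtain ⟨i, hi⟩ := Finset.card_pos.mp (hM ▸ hpos)
  have h1 := sum_parity_mul_eval (hM.ge : (expansion g).totalDegree ≤ M.card) w
  simp_rw [eval_cubePoint_expansion, hconst] at h1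
  rw [sum_parity_mul_eq_zero hi _ fun _ => rfl] at h1
  exact mul_ne_zero hc (paritySum_ne_zero M) h1.symm

/-- Querying a monomial of maximal degree decreases the block sensitivity. -/
theorem blockSens_piecewise_lt {n : ℕ} {g : (Fin n → Bool) → Bool} {M : Finset (Fin n)}
    (hM : M.card = deg g) (hc : (expansion g).coeff (exponent M) ≠ 0) (hpos : 0 < deg g)
    (z : Fin n → Bool) : blockSens (fun x => g (M.piecewise z x)) < blockSens g := by
  obtain ⟨x, -, hx⟩ := Finset.exists_mem_eq_sup (Finset.univ : Finset (Fin n → Bool))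
    Finset.univ_nonempty (blockSensAt fun x => g (M.piecewise z x))
  rw [blockSens, hx]
  obtain ⟨B, hd, hs⟩ := exists_blocks (fun x => g (M.piecewise z x)) x
  obtain ⟨S, hSM, hS⟩ := exists_sensitive_subset hM hc hpos (M.piecewise z x)
  refine lt_of_lt_of_le ?_ (blockSensAt_le g (M.piecewise z x))
  -- Bits in M do not affect the restricted function, so its blocks stay sensitive after removing M;
  -- this makes room for S as an extra block, indexed by `none`.
  have h := card_le_blockSensAt (f := g) (x := M.piecewise z x)
    (B := fun o : Option (Fin (blockSensAt (fun x => g (M.piecewise z x)) x)) =>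
      o.elim S fun j => B j \ M) ?_ ?_
  · simpa using h
  · rintro (_ | j) (_ | k) hjk
    · exact absurd rfl hjk
    · exact Disjoint.mono_left hSM Finset.disjoint_sdiff
    · exact Disjoint.mono_right hSM Finset.sdiff_disjoint
    · exact Disjoint.mono Finset.sdiff_subset Finset.sdiff_subset (hd fun h => hjk (by rw [h]))
  · rintro (_ | j)
    · exact hS
    · convert hs j using 2
      funext i
      by_cases hi : i ∈ M <;> simp [flip, hi]

/-- Each round queries a monomial of maximal degree: at most d queries, bs drops by at least one,
and the degree does not grow. When bs is 0 the function is constant, since the set where two inputs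
with different values differ is a sensitive block. -/
theorem exists_queryTree_queries_le {n d : ℕ} (k : ℕ) (g : (Fin n → Bool) → Bool)
    (hd : deg g ≤ d) (hk : blockSens g ≤ k) :
    ∃ t : QueryTree n, ∀ x, t.output x = g x ∧ t.queries x ≤ k * d := by
  induction k generalizing g with
  | zero =>
    refine ⟨.leaf (g fun _ => false), fun x => ⟨?_, by simp [QueryTree.queries]⟩⟩
    by_contra hne
    have h := card_le_blockSensAt (f := g) (x := fun _ => false)
      (B := fun _ : Unit => Finset.univ.filter fun i => (fun _ => false : Fin n → Bool) i ≠ x i)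
      (fun _ _ h => absurd rfl h) fun _ => by rwa [flip_filter_ne]
    have := blockSensAt_le g fun _ => false
    simp at h
    omega
  | succ k ih =>
    by_cases hc : ∀ x y, g x = g y
    · exact ⟨.leaf (g fun _ => false), fun x => ⟨hc _ _, by simp [QueryTree.queries]⟩⟩
    push Not at hc
    obtain ⟨x, y, hxy⟩ := hc
    have hpos := deg_pos hxy
    have hne : expansion g ≠ 0 := by
      intro h0
      simp [deg, h0] at hpos
    obtain ⟨M, hM, hcM⟩ := exists_card_eq_deg g hne
    obtain ⟨t, ht⟩ := exists_queryTree_of_piecewise M g fun z =>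
      ih (fun x => g (M.piecewise z x)) ((deg_piecewise_le g M z).trans hd)
        (by have := blockSens_piecewise_lt hM hcM hpos z; omega)
    refine ⟨t, fun x => ⟨(ht x).1, (ht x).2.trans ?_⟩⟩
    rw [Nat.succ_mul]
    omega

theorem dtDepth_le {n : ℕ} (f : (Fin n → Bool) → Bool) : dtDepth f ≤ blockSens f * deg f := by
  obtain ⟨t, ht⟩ := exists_queryTree_queries_le (blockSens f) f le_rfl le_rfl
  have h : dtDepth f ≤ t.cost := by
    unfold dtDepth
    exact Nat.sInf_le ⟨t, fun x => (ht x).1, rfl⟩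
  exact h.trans (Finset.sup_le fun x _ => (ht x).2)

/-! ### Block sensitivity against degree. -/

/-- Markov's inequality for the second derivative at an endpoint of `[0, 1]`. -/
theorem neg_coeff_two_le {d : ℕ} {q : Polynomial ℝ} (hd : q.natDegree ≤ d)
    (h0 : ∀ t ∈ Set.Icc (0 : ℝ) 1, 0 ≤ q.eval t) (h1 : ∀ t ∈ Set.Icc (0 : ℝ) 1, q.eval t ≤ 1) :
    -q.coeff 2 ≤ (d : ℝ) ^ 2 * ((d : ℝ) ^ 2 - 1) / 3 := by
  open Polynomial in
  -- The affine changes carry [-1, 1] to [0, 1] with 1 ↦ 0, and values in [0, 1] to [-1, 1]; the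
  -- scaling gives P''(1) = -2·(1/4)·q''(0), which is minus the t² coefficient of q.
  let P : ℝ[X] := 1 - C 2 * q.comp (C (1 / 2) - C (1 / 2) * X)
  have hlin : (C (1 / 2) - C (1 / 2) * X : ℝ[X]).natDegree ≤ 1 := by compute_degree
  have hdeg : P.degree ≤ d := by
    rw [← natDegree_le_iff_degree_le]
    have hcomp : (q.comp (C (1 / 2) - C (1 / 2) * X)).natDegree ≤ d := by
      refine natDegree_comp_le.trans ?_
      nlinarith
    exact (natDegree_sub_le _ _).trans
      (max_le (natDegree_one.le.trans (Nat.zero_le d)) ((natDegree_C_mul_le _ _).trans hcomp))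
  have hbnd : ∀ x ∈ Set.Icc (-1 : ℝ) 1, |P.eval x| ≤ 1 := by
    intro x hx
    have hmem : 1 / 2 - 1 / 2 * x ∈ Set.Icc (0 : ℝ) 1 := by
      constructor <;> linarith [hx.1, hx.2]
    have h0' := h0 _ hmem
    have h1' := h1 _ hmem
    simp only [P, eval_sub, eval_one, eval_mul, eval_C, eval_comp, eval_X]
    rw [abs_le]
    constructor <;> linarith
  have hmain := Chebyshev.eval_iterate_derivative_le_of_forall_abs_le_one (k := 2) le_rfl hdeg hbnd
  have hT : (derivative^[2] (Chebyshev.T ℝ d)).eval 1 = (d : ℝ) ^ 2 * ((d : ℝ) ^ 2 - 1) / 3 := by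
    have h := Chebyshev.iterate_derivative_T_eval_one (R := ℝ) d 2
    simp [Finset.prod_range_succ] at h
    simp only [Function.iterate_succ, Function.iterate_zero, Function.comp_apply, id]
    linarith
  have hP : (derivative^[2] P).eval 1 = -q.coeff 2 := by
    have h := coeff_iterate_derivative (p := q) (k := 2) 0
    simp only [Function.iterate_succ, Function.iterate_zero, Function.comp_apply, id] at h ⊢
    rw [coeff_zero_eq_eval_zero] at h
    simp [P, derivative_comp, h]
  rw [hP, hT] at hmain
  exact hmain

/-- The restriction of the expansion of `g` to the diagonal. -/
noncomputable def diagonal {k : ℕ} (g : (Fin k → Bool) → Bool) : Polynomial ℝ :=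
  MvPolynomial.aeval (fun _ => Polynomial.X) (expansion g)

theorem diagonal_eq {k : ℕ} (g : (Fin k → Bool) → Bool) :
    diagonal g = ∑ a : Fin k → Bool, if g a = true then
      ∏ i : Fin k, (if a i = true then Polynomial.X else 1 - Polynomial.X) else 0 := by
  simp only [diagonal, expansion, map_sum, apply_ite (MvPolynomial.aeval _), map_prod, map_sub,
    map_one, map_zero, MvPolynomial.aeval_X]

theorem natDegree_diagonal_le {k : ℕ} (g : (Fin k → Bool) → Bool) :
    (diagonal g).natDegree ≤ deg g := by
  have h := MvPolynomial.aeval_natDegree_le (n := 1) (expansion g) le_rfl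
    (fun _ => Polynomial.X) fun _ => Polynomial.natDegree_X_le
  rwa [mul_one] at h

/-- The value at t is the probability of g = 1 on independent bits that are 1 with probability t. -/
theorem eval_diagonal_mem {k : ℕ} (g : (Fin k → Bool) → Bool) {t : ℝ} (ht : t ∈ Set.Icc (0 : ℝ) 1) :
    0 ≤ (diagonal g).eval t ∧ (diagonal g).eval t ≤ 1 := by
  have hnonneg : ∀ a : Fin k → Bool, 0 ≤ ∏ i : Fin k, (if a i = true then t else 1 - t) :=
    fun a => Finset.prod_nonneg fun i _ => by
      split_ifs
      · exact ht.1
      · linarith [ht.2]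
  have heval : (diagonal g).eval t = ∑ a : Fin k → Bool, if g a = true then
      ∏ i : Fin k, (if a i = true then t else 1 - t) else 0 := by
    simp only [diagonal_eq, Polynomial.eval_finsetSum, apply_ite (Polynomial.eval t),
      Polynomial.eval_prod, Polynomial.eval_sub, Polynomial.eval_one, Polynomial.eval_zero,
      Polynomial.eval_X]
  have hone : ∑ a : Fin k → Bool, ∏ i : Fin k, (if a i = true then t else 1 - t) = 1 := by
    rw [← Fintype.prod_sum fun (_ : Fin k) (b : Bool) => if b = true then t else 1 - t]
    simp
  rw [heval]
  refine ⟨Finset.sum_nonneg fun a _ => ?_, (Finset.sum_le_sum fun a _ => ?_).trans hone.le⟩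
  · split_ifs
    exacts [hnonneg a, le_rfl]
  · split_ifs
    exacts [le_rfl, hnonneg a]

theorem coeff_one_one_sub_X_pow (m : ℕ) :
    ((1 - Polynomial.X : Polynomial ℝ) ^ m).coeff 1 = -m := by
  induction m with
  | zero => simp [Polynomial.coeff_one]
  | succ m ih =>
    rw [pow_succ, mul_sub, mul_one, Polynomial.coeff_sub, ih, Polynomial.coeff_mul_X,
      Polynomial.coeff_zero_eq_eval_zero]
    simp
    ring

/-- The number of ones of a bit string. -/
def weight {k : ℕ} (a : Fin k → Bool) : ℕ := (Finset.univ.filter fun i => a i = true).card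

theorem sum_apply_weight {k : ℕ} (u : ℕ → ℝ) :
    ∑ a : Fin k → Bool, u (weight a) = ∑ m ∈ Finset.range (k + 1), (k.choose m : ℝ) * u m := by
  have h := Finset.sum_powerset_apply_card u (x := (Finset.univ : Finset (Fin k)))
  simp only [Finset.card_univ, Fintype.card_fin, nsmul_eq_mul] at h
  rw [← h]
  refine Finset.sum_nbij' (fun a => Finset.univ.filter fun i => a i = true)
    (fun s i => decide (i ∈ s)) ?_ ?_ ?_ ?_ ?_ <;> simp [weight]

theorem coeff_two_diagonal_le {k : ℕ} {g : (Fin k → Bool) → Bool} (h0 : g (fun _ => false) = false)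
    (h1 : ∀ j, g (flip (fun _ => false) {j}) = true) :
    (diagonal g).coeff 2 ≤ -(k.choose 2 : ℝ) := by
  -- Weight 1 contributes exactly -(k - 1), from t(1 - t)^(k-1); weight 2 contributes 0 or 1; other
  -- weights contribute 0. The total is at most -k(k - 1) + C(k,2).
  let u : ℕ → ℝ := fun m => (if m = 1 then -((k : ℝ) - 1) else 0) + if m = 2 then 1 else 0
  have hterm : ∀ a : Fin k → Bool, (if g a = true then
      ∏ i : Fin k, (if a i = true then Polynomial.X else 1 - Polynomial.X) else 0 :
        Polynomial ℝ).coeff 2 ≤ u (weight a) := by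
    intro a
    have hprod : ∏ i : Fin k, (if a i = true then Polynomial.X else 1 - Polynomial.X) =
        (Polynomial.X : Polynomial ℝ) ^ weight a * (1 - Polynomial.X) ^ (k - weight a) := by
      rw [Finset.prod_ite, Finset.prod_const, Finset.prod_const, weight, Finset.filter_not,
        Finset.card_sdiff_of_subset (Finset.filter_subset _ _), Finset.card_univ, Fintype.card_fin]
    rw [hprod]
    rcases lt_or_ge 2 (weight a) with hw | hw
    · have hu : u (weight a) = 0 := by
        simp [u, hw.ne', (show weight a ≠ 1 by omega)]
      rw [hu]
      split_ifs
      · rw [Polynomial.coeff_X_pow_mul', if_neg (by omega)]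
      · simp
    · interval_cases hwa : weight a
      · have ha : a = fun _ => false := by
          funext i
          simpa using Finset.filter_eq_empty_iff.mp (Finset.card_eq_zero.mp hwa) (Finset.mem_univ i)
        simp [ha, h0, u]
      · obtain ⟨j, hj⟩ := Finset.card_eq_one.mp hwa
        have ha : a = flip (fun _ => false) {j} := by
          funext i
          have h := Finset.ext_iff.mp hj i
          simp only [Finset.mem_filter, Finset.mem_univ, true_and, Finset.mem_singleton] at h
          by_cases hij : i = j
          · rw [h.mpr hij]
            simp [flip, hij]
          · simpa [flip, hij] using h
        have hk : 1 ≤ k := j.pos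
        rw [ha, h1, if_pos rfl, Polynomial.coeff_X_pow_mul', if_pos (by norm_num)]
        norm_num [coeff_one_one_sub_X_pow, u, Nat.cast_sub hk]
      · split_ifs
        · rw [Polynomial.coeff_X_pow_mul', if_pos le_rfl]
          simp [u, Polynomial.coeff_zero_eq_eval_zero]
        · simp [u]
  rw [diagonal_eq, Polynomial.finsetSum_coeff]
  refine (Finset.sum_le_sum fun a _ => hterm a).trans (le_of_eq ?_)
  rw [sum_apply_weight]
  simp only [u, mul_add, mul_ite, mul_zero, mul_one, Finset.sum_add_distrib,
    Finset.sum_ite_eq', Finset.mem_range, Nat.choose_one_right]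
  rcases k with _ | _ | k
  · simp
  · simp
  · simp only [Nat.cast_choose_two]
    rw [if_pos (by omega), if_pos (by omega)]
    ring

theorem deg_xor_le {k : ℕ} (b : Bool) (g : (Fin k → Bool) → Bool) :
    deg (fun y => xor b (g y)) ≤ deg g := by
  cases b
  · simp
  · refine (deg_le_totalDegree _ (1 - expansion g) fun x => ?_).trans
      ((MvPolynomial.totalDegree_sub _ _).trans (by simp [deg]))
    rw [map_sub, eval_cubePoint_expansion]
    cases g x <;> simp

/-- Let y select which blocks to flip. By disjointness each bit of the resulting input is a
constant, y_j or 1 - y_j, so the degree does not grow; the xor with `f x` normalises the value at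
the origin to 0. -/
theorem choose_blockSensAt_le {n : ℕ} (f : (Fin n → Bool) → Bool) (x : Fin n → Bool) :
    ((blockSensAt f x).choose 2 : ℝ) ≤ (deg f : ℝ) ^ 2 * ((deg f : ℝ) ^ 2 - 1) / 3 := by
  classical
  obtain ⟨B, hd, hs⟩ := exists_blocks f x
  let φ : (Fin (blockSensAt f x) → Bool) → Fin n → Bool :=
    fun y => flip x (Finset.univ.filter fun i => ∃ j, y j = true ∧ i ∈ B j)
  let g : (Fin (blockSensAt f x) → Bool) → Bool := fun y => xor (f x) (f (φ y))
  have hdeg : deg g ≤ deg f := by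
    refine (deg_xor_le _ _).trans (deg_comp_le f φ fun i => ?_)
    by_cases hi : ∃ j, i ∈ B j
    · obtain ⟨j, hj⟩ := hi
      have hiff : ∀ y : Fin (blockSensAt f x) → Bool, (∃ k, y k = true ∧ i ∈ B k) ↔ y j = true := by
        refine fun y => ⟨?_, fun h => ⟨j, h, hj⟩⟩
        rintro ⟨k, hk, hik⟩
        by_cases hkj : k = j
        · rwa [← hkj]
        · exact absurd hj (Finset.disjoint_left.mp (hd hkj) hik)
      cases hx : x i
      · refine ⟨MvPolynomial.X j, by simp, fun y => ?_⟩
        cases hy : y j <;> simp [cubePoint, φ, flip, hiff, hx, hy]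
      · refine ⟨1 - MvPolynomial.X j, (MvPolynomial.totalDegree_sub _ _).trans (by simp),
          fun y => ?_⟩
        cases hy : y j <;> simp [cubePoint, φ, flip, hiff, hx, hy]
    · push Not at hi
      exact ⟨MvPolynomial.C (cubePoint x i), by simp, fun y => by simp [cubePoint, φ, flip, hi]⟩
  have hzero : g (fun _ => false) = false := by
    simp [g, φ, flip_empty]
  have hone : ∀ j, g (flip (fun _ => false) {j}) = true := by
    intro j
    have hφ : φ (flip (fun _ => false) {j}) = flip x (B j) := by
      simp [φ, flip]
    have := hs j
    simp only [g, hφ]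
    cases h1 : f x <;> cases h2 : f (flip x (B j)) <;> simp_all
  have h1 := coeff_two_diagonal_le hzero hone
  have h2 := neg_coeff_two_le ((natDegree_diagonal_le g).trans hdeg)
    (fun t ht => (eval_diagonal_mem g ht).1) fun t ht => (eval_diagonal_mem g ht).2
  linarith

theorem blockSens_le {n : ℕ} (f : (Fin n → Bool) → Bool) :
    (blockSens f : ℝ) ≤ Real.sqrt (2 / 3) * (deg f : ℝ) ^ 2 + 1 := by
  obtain ⟨x, -, hx⟩ := Finset.exists_mem_eq_sup (Finset.univ : Finset (Fin n → Bool))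
    Finset.univ_nonempty (blockSensAt f)
  rw [blockSens, hx]
  have h := choose_blockSensAt_le f x
  rw [Nat.cast_choose_two] at h
  rcases Nat.eq_zero_or_pos (blockSensAt f x) with h0 | hpos
  · rw [h0]
    simp only [Nat.cast_zero]
    positivity
  have hpos' : (1 : ℝ) ≤ blockSensAt f x := by exact_mod_cast hpos
  have hsq : Real.sqrt (2 / 3) * (deg f : ℝ) ^ 2 = Real.sqrt (2 / 3 * ((deg f : ℝ) ^ 2) ^ 2) := by
    rw [Real.sqrt_mul (by norm_num), Real.sqrt_sq (by positivity)]
  rw [hsq, ← sub_le_iff_le_add]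
  refine Real.le_sqrt_of_sq_le ?_
  -- (k - 1)² ≤ k(k - 1) ≤ (2/3)·d²(d² - 1) ≤ (2/3)·d⁴; the first step needs k ≥ 1.
  nlinarith [sq_nonneg (deg f : ℝ)]

/-! ### Huang's theorem and degree against sensitivity. -/

theorem parity_flip_of_notMem {n : ℕ} {M : Finset (Fin n)} {i : Fin n} (hi : i ∉ M)
    (x : Fin n → Bool) : parity M (flip x {i}) = parity M x := by
  refine Finset.prod_congr rfl fun j hj => ?_
  have hji : j ≠ i := fun h => hi (h ▸ hj)
  simp [flip, hji]

theorem parity_mul_self {n : ℕ} (M : Finset (Fin n)) (x : Fin n → Bool) :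
    parity M x * parity M x = 1 := by
  rw [parity, ← Finset.prod_mul_distrib]
  exact Finset.prod_eq_one fun i _ => by split_ifs <;> norm_num

theorem flip_flip_comm {n : ℕ} (x : Fin n → Bool) (S T : Finset (Fin n)) :
    flip (flip x S) T = flip (flip x T) S := by
  funext i
  by_cases hS : i ∈ S <;> by_cases hT : i ∈ T <;> simp [flip, hS, hT]

/-- Huang's signed adjacency operator of the cube in the directions `M`. -/
def signedAdj {n : ℕ} (M : Finset (Fin n)) :
    ((Fin n → Bool) → ℝ) →ₗ[ℝ] ((Fin n → Bool) → ℝ) where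
  toFun v x := ∑ i ∈ M, parity (Finset.Iio i) x * v (flip x {i})
  map_add' v w := by
    funext x
    simp [mul_add, Finset.sum_add_distrib]
  map_smul' c v := by
    funext x
    simp [Finset.mul_sum, mul_left_comm]

theorem signedAdj_apply {n : ℕ} (M : Finset (Fin n)) (v : (Fin n → Bool) → ℝ) (x : Fin n → Bool) :
    signedAdj M v x = ∑ i ∈ M, parity (Finset.Iio i) x * v (flip x {i}) := rfl

/-- For i < j, flipping i changes the sign attached to j but not conversely, so the two orders of
flipping i and j cancel. Only the terms i = j survive, each giving v. -/
theorem signedAdj_signedAdj {n : ℕ} (M : Finset (Fin n)) (v : (Fin n → Bool) → ℝ) :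
    signedAdj M (signedAdj M v) = (M.card : ℝ) • v := by
  funext x
  let T : Fin n → Fin n → ℝ := fun i j =>
    parity (Finset.Iio i) x * (parity (Finset.Iio j) (flip x {i}) * v (flip (flip x {i}) {j}))
  have hlt : ∀ i j, i < j → T i j + T j i = 0 := by
    intro i j hij
    simp only [T]
    rw [parity_flip_singleton (Finset.mem_Iio.mpr hij),
      parity_flip_of_notMem (by simpa using hij.le), flip_flip_comm x {j} {i}]
    ring
  have hT : ∀ i j, T i j + T j i = if i = j then 2 * v x else 0 := by
    intro i j
    rcases lt_trichotomy i j with h | rfl | h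
    · rw [hlt i j h, if_neg h.ne]
    · simp only [T, if_true, flip_flip]
      rw [parity_flip_of_notMem (by simp), ← mul_assoc, parity_mul_self]
      ring
    · rw [add_comm, hlt j i h, if_neg h.ne']
  have hsum : signedAdj M (signedAdj M v) x = ∑ i ∈ M, ∑ j ∈ M, T i j := by
    simp only [signedAdj_apply, Finset.mul_sum, T]
  have h2 : ∑ i ∈ M, ∑ j ∈ M, T i j + ∑ i ∈ M, ∑ j ∈ M, T i j = M.card * (2 * v x) := by
    nth_rw 2 [Finset.sum_comm]
    simp only [← Finset.sum_add_distrib, hT]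
    simp
  rw [hsum, Pi.smul_apply, smul_eq_mul]
  linarith

/-- Multiplication by the parity character. -/
def parityMul {n : ℕ} (M : Finset (Fin n)) :
    ((Fin n → Bool) → ℝ) →ₗ[ℝ] ((Fin n → Bool) → ℝ) :=
  LinearMap.mulLeft ℝ (parity M)

theorem parityMul_apply {n : ℕ} (M : Finset (Fin n)) (v : (Fin n → Bool) → ℝ)
    (x : Fin n → Bool) : parityMul M v x = parity M x * v x := rfl

theorem parityMul_parityMul {n : ℕ} (M : Finset (Fin n)) (v : (Fin n → Bool) → ℝ) :
    parityMul M (parityMul M v) = v := by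
  funext x
  rw [parityMul_apply, parityMul_apply, ← mul_assoc, parity_mul_self, one_mul]

/-- Anticommutation makes the parity character exchange the eigenspaces of √|M| and -√|M|. -/
theorem signedAdj_parityMul {n : ℕ} (M : Finset (Fin n)) (v : (Fin n → Bool) → ℝ) :
    signedAdj M (parityMul M v) = -parityMul M (signedAdj M v) := by
  funext x
  rw [Pi.neg_apply, parityMul_apply, signedAdj_apply, signedAdj_apply, Finset.mul_sum,
    ← Finset.sum_neg_distrib]
  refine Finset.sum_congr rfl fun i hi => ?_
  rw [parityMul_apply, parity_flip_singleton hi]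
  ring

/-- With A² = s², both the range of A + s and the parity image of its kernel lie in the kernel of A
- s; rank-nullity adds their dimensions to 2^n. -/
theorem two_pow_le_finrank {n : ℕ} (M : Finset (Fin n)) :
    2 ^ n ≤ 2 * Module.finrank ℝ
      (LinearMap.ker (signedAdj M - Real.sqrt M.card • LinearMap.id)) := by
  set s := Real.sqrt M.card
  have hs : s * s = M.card := Real.mul_self_sqrt (Nat.cast_nonneg _)
  have hrange : LinearMap.range (signedAdj M + s • LinearMap.id) ≤
      LinearMap.ker (signedAdj M - s • LinearMap.id) := by
    rintro _ ⟨v, rfl⟩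
    simp only [LinearMap.mem_ker, LinearMap.sub_apply, LinearMap.add_apply, LinearMap.smul_apply,
      LinearMap.id_apply, map_add, map_smul, signedAdj_signedAdj]
    rw [smul_sub, smul_smul, hs]
    abel
  have hker : (LinearMap.ker (signedAdj M + s • LinearMap.id)).map (parityMul M) ≤
      LinearMap.ker (signedAdj M - s • LinearMap.id) := by
    rintro _ ⟨v, hv, rfl⟩
    have hv' : signedAdj M v + s • v = 0 := hv
    simp only [LinearMap.mem_ker, LinearMap.sub_apply, LinearMap.smul_apply, LinearMap.id_apply,
      signedAdj_parityMul]
    rw [← map_smul, ← neg_add', ← map_add, hv', map_zero, neg_zero]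
  have hinj : Function.Injective (parityMul M) :=
    Function.LeftInverse.injective (parityMul_parityMul M)
  have h1 := Submodule.finrank_mono hrange
  have h2 := Submodule.finrank_mono hker
  rw [(Submodule.equivMapOfInjective _ hinj _).symm.finrank_eq] at h2
  have h3 := LinearMap.finrank_range_add_finrank_ker (signedAdj M + s • LinearMap.id)
  have h4 : Module.finrank ℝ ((Fin n → Bool) → ℝ) = 2 ^ n := by simp
  omega

/-- Huang's theorem: a set of more than half of the points of the cube contains a point with at
least `√|M|` neighbours in directions `M` in the set. -/
theorem exists_sqrt_le_card {n : ℕ} (M : Finset (Fin n)) (H : Finset (Fin n → Bool))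
    (hH : 2 ^ n < 2 * H.card) :
    ∃ x ∈ H, Real.sqrt M.card ≤ (M.filter fun i => flip x {i} ∈ H).card := by
  let E := LinearMap.ker (signedAdj M - Real.sqrt M.card • LinearMap.id)
  let R : E →ₗ[ℝ] ({x // x ∉ H} → ℝ) :=
    (LinearMap.funLeft ℝ ℝ (Subtype.val : {x // x ∉ H} → _)) ∘ₗ E.subtype
  -- The eigenspace has dimension at least half of 2^n, more than the number of points outside H, so
  -- some nonzero eigenvector vanishes off H. A point where it is largest in absolute value is the
  -- desired one.
  have hdim : Module.finrank ℝ ({x // x ∉ H} → ℝ) < Module.finrank ℝ E := by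
    have h1 := two_pow_le_finrank M
    have h2 : Fintype.card {x // x ∉ H} = 2 ^ n - H.card := by
      simp [Fintype.card_subtype_compl]
    rw [Module.finrank_fintype_fun_eq_card, h2]
    change 2 ^ n ≤ 2 * Module.finrank ℝ E at h1
    have : H.card ≤ 2 ^ n := by simpa using Finset.card_le_univ H
    omega
  obtain ⟨⟨v, hvE⟩, hvR, hv0⟩ :=
    Submodule.exists_mem_ne_zero_of_ne_bot (LinearMap.ker_ne_bot_of_finrank_lt (f := R) hdim)
  have hv0' : v ≠ 0 := fun h => hv0 (Subtype.ext h)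
  have hout : ∀ x, x ∉ H → v x = 0 := fun x hx => congrFun (LinearMap.mem_ker.mp hvR) ⟨x, hx⟩
  have hev : ∀ x, ∑ i ∈ M, parity (Finset.Iio i) x * v (flip x {i}) = Real.sqrt M.card * v x := by
    intro x
    have h : signedAdj M v - Real.sqrt M.card • v = 0 := hvE
    exact congrFun (sub_eq_zero.mp h) x
  obtain ⟨x, -, hx⟩ := Finset.exists_max_image Finset.univ (fun x => |v x|) Finset.univ_nonempty
  have hpos : 0 < |v x| := by
    obtain ⟨y, hy⟩ := Function.ne_iff.mp hv0'
    exact (abs_pos.mpr hy).trans_le (hx y (Finset.mem_univ y))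
  refine ⟨x, by_contra fun h => abs_pos.mp hpos (hout x h), le_of_mul_le_mul_right ?_ hpos⟩
  have habs : ∀ S : Finset (Fin n), |parity S x| = 1 := fun S => by
    rcases mul_self_eq_one_iff.mp (parity_mul_self S x) with h | h <;> simp [h]
  calc Real.sqrt M.card * |v x| = |∑ i ∈ M, parity (Finset.Iio i) x * v (flip x {i})| := by
        rw [hev, abs_mul, abs_of_nonneg (Real.sqrt_nonneg _)]
    _ ≤ ∑ i ∈ M, |v (flip x {i})| := by
        refine (Finset.abs_sum_le_sum_abs _ _).trans (Finset.sum_le_sum fun i _ => ?_)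
        rw [abs_mul, habs, one_mul]
    _ = ∑ i ∈ M.filter fun i => flip x {i} ∈ H, |v (flip x {i})| := by
        rw [Finset.sum_filter]
        refine Finset.sum_congr rfl fun i _ => ?_
        split_ifs with h
        · rfl
        · rw [hout _ h, abs_zero]
    _ ≤ ∑ i ∈ M.filter fun i => flip x {i} ∈ H, |v x| :=
        Finset.sum_le_sum fun i _ => hx _ (Finset.mem_univ _)
    _ = (M.filter fun i => flip x {i} ∈ H).card * |v x| := by simp

/-- Multiply (-1)^f on a subcube in directions M by the parity. The sum is a nonzero multiple of the
top coefficient, so one sign occupies more than half of the cube. A step in M between two points of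
that sign flips the parity, so it must flip f too; Huang's theorem finds a point with √d such steps.
-/
theorem deg_le_sens_sq {n : ℕ} (f : (Fin n → Bool) → Bool) : deg f ≤ sens f ^ 2 := by
  rcases Nat.eq_zero_or_pos (deg f) with h0 | hpos
  · omega
  have hne : expansion f ≠ 0 := by
    intro h0
    simp [deg, h0] at hpos
  obtain ⟨M, hM, hc⟩ := exists_card_eq_deg f hne
  obtain ⟨i₀, hi₀⟩ := Finset.card_pos.mp (hM ▸ hpos)
  let w : Fin n → Bool := fun _ => false
  -- z ranges over the whole cube, though f sees only its bits in M: each subcube point is counted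
  -- equally often.
  let ε : (Fin n → Bool) → ℝ := fun z => parity M z * if f (M.piecewise z w) = true then -1 else 1
  have hε : ∀ z, ε z = 1 ∨ ε z = -1 := by
    intro z
    rcases mul_self_eq_one_iff.mp (parity_mul_self M z) with h | h <;>
      simp only [ε, h] <;> split_ifs <;> norm_num
  have hsum : ∑ z, ε z ≠ 0 := by
    have h1 := sum_parity_mul_eval (hM.ge : (expansion f).totalDegree ≤ M.card) w
    have h2 := sum_parity_mul_eq_zero hi₀ (fun _ => 1) fun _ => rfl
    have h3 : ∑ z, ε z = ∑ z, parity M z * 1 -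
        2 * ∑ z, parity M z * MvPolynomial.eval (cubePoint (M.piecewise z w)) (expansion f) := by
      rw [Finset.mul_sum, ← Finset.sum_sub_distrib]
      refine Finset.sum_congr rfl fun z _ => ?_
      rw [eval_cubePoint_expansion]
      simp only [ε]
      split_ifs <;> ring
    rw [h3, h2, h1, zero_sub]
    exact neg_ne_zero.mpr
      (mul_ne_zero two_ne_zero (mul_ne_zero hc (paritySum_ne_zero M)))
  have hmajority : ∃ H : Finset (Fin n → Bool), 2 ^ n < 2 * H.card ∧
      ∀ x ∈ H, ∀ y ∈ H, ε x = ε y := by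
    let H := Finset.univ.filter fun z => ε z = 1
    have hcard : H.card + Hᶜ.card = 2 ^ n := by
      rw [Finset.card_add_card_compl]
      simp
    have hsum' : ∑ z, ε z = H.card - Hᶜ.card := by
      have h1 : ∑ z ∈ H, ε z = ∑ z ∈ H, 1 :=
        Finset.sum_congr rfl fun z hz => (Finset.mem_filter.mp hz).2
      have h2 : ∑ z ∈ Hᶜ, ε z = ∑ z ∈ Hᶜ, -1 :=
        Finset.sum_congr rfl fun z hz => (hε z).resolve_left (by simpa [H] using hz)
      rw [← Finset.sum_add_sum_compl H, h1, h2]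
      simp only [Finset.sum_const, nsmul_eq_mul]
      ring
    have hne' : H.card ≠ Hᶜ.card := fun h => hsum (by rw [hsum', h, sub_self])
    rcases lt_or_gt_of_ne hne' with h | h
    · refine ⟨Hᶜ, by omega, fun x hx y hy => ?_⟩
      rw [(hε x).resolve_left (by simpa [H] using hx), (hε y).resolve_left (by simpa [H] using hy)]
    · refine ⟨H, by omega, fun x hx y hy => ?_⟩
      rw [(Finset.mem_filter.mp hx).2, (Finset.mem_filter.mp hy).2]
  obtain ⟨H, hH, hHε⟩ := hmajority
  obtain ⟨x, hx, hle⟩ := exists_sqrt_le_card M H hH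
  have hsub : (M.filter fun i => flip x {i} ∈ H).card ≤ sens f := by
    refine le_trans (Finset.card_le_card fun i hi => ?_) (sensAt_le f (M.piecewise x w))
    obtain ⟨hiM, hiH⟩ := Finset.mem_filter.mp hi
    have hflip : M.piecewise (flip x {i}) w = flip (M.piecewise x w) {i} := by
      funext j
      by_cases hji : j = i
      · subst hji
        simp [flip, hiM]
      · by_cases hj : j ∈ M <;> simp [flip, hj, hji]
    refine Finset.mem_filter.mpr ⟨Finset.mem_univ i, fun heq => ?_⟩
    have h := hHε x hx _ hiH
    have hx0 : ε x ≠ 0 := by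
      rcases hε x with h | h <;> rw [h] <;> norm_num
    have hneg : ε (flip x {i}) = -ε x := by
      simp only [ε]
      rw [hflip, ← heq, parity_flip_singleton hiM, neg_mul]
    rw [hneg] at h
    exact hx0 (by linarith)
  rw [hM] at hle
  have h1 : Real.sqrt (deg f) ≤ sens f := hle.trans (by exact_mod_cast hsub)
  have h2 := (Real.sqrt_le_left (Nat.cast_nonneg _)).mp h1
  exact_mod_cast h2

end BoolFn

/-! ### Combining the inequalities. -/

theorem mainTheorem10 (n : ℕ) (f : (Fin n → Bool) → Bool) :
    (BoolFn.blockSens f : ℝ) ≤ Real.sqrt (2 / 3) * (BoolFn.sens f : ℝ) ^ 4 + 1 ∧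
    (BoolFn.dtDepth f : ℝ) ≤ Real.sqrt (2 / 3) * (BoolFn.deg f : ℝ) ^ 3 + (BoolFn.deg f : ℝ) ∧
    (BoolFn.cert f : ℝ) ≤ Real.sqrt (2 / 3) * (BoolFn.sens f : ℝ) ^ 5 + (BoolFn.sens f : ℝ) := by
  have hbs := BoolFn.blockSens_le f
  have hdeg : (BoolFn.deg f : ℝ) ≤ (BoolFn.sens f : ℝ) ^ 2 := by
    exact_mod_cast BoolFn.deg_le_sens_sq f
  have hdt : (BoolFn.dtDepth f : ℝ) ≤ BoolFn.blockSens f * BoolFn.deg f := by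
    exact_mod_cast BoolFn.dtDepth_le f
  have hcert : (BoolFn.cert f : ℝ) ≤ BoolFn.blockSens f * BoolFn.sens f := by
    exact_mod_cast BoolFn.cert_le f
  have hbs' : (BoolFn.blockSens f : ℝ) ≤ Real.sqrt (2 / 3) * (BoolFn.sens f : ℝ) ^ 4 + 1 := by
    calc (BoolFn.blockSens f : ℝ) ≤ Real.sqrt (2 / 3) * (BoolFn.deg f : ℝ) ^ 2 + 1 := hbs
      _ ≤ Real.sqrt (2 / 3) * ((BoolFn.sens f : ℝ) ^ 2) ^ 2 + 1 := by gcongr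
      _ = _ := by ring
  refine ⟨hbs', ?_, ?_⟩
  · calc (BoolFn.dtDepth f : ℝ) ≤ BoolFn.blockSens f * BoolFn.deg f := hdt
      _ ≤ (Real.sqrt (2 / 3) * (BoolFn.deg f : ℝ) ^ 2 + 1) * BoolFn.deg f := by gcongr
      _ = _ := by ring
  · calc (BoolFn.cert f : ℝ) ≤ BoolFn.blockSens f * BoolFn.sens f := hcert
      _ ≤ (Real.sqrt (2 / 3) * (BoolFn.sens f : ℝ) ^ 4 + 1) * BoolFn.sens f := by gcongr
      _ = _ := by ring
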